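/- Conventions. All graphs are finite and simple. For a graph $G=(V,E)$, an induced matching is a matching $M\subseteq E$ such that no edge of $G$ joins two different edges of $M$. The induced matching polytope $Q(G)\subseteq\mathbb{R}^{E}$ is the convex hull of the $0/1$ incidence vectors of all induced matchings of $G$ (it is full-dimensional). The extension complexity $\mathrm{xc}(Q)$ of a polyhedron $Q$ is the minimum number of facets of a polyhedron $P\subseteq\mathbb{R}^d$ ($d$ arbitrary) such that $Q$ is the image of $P$ under a linear map. For a set $H$ of inequalities valid for a full-dimensional polytope $Q$, let $Q_H$ be the polyhedron obtained from the facet description of $Q$ by deleting every facet-defining half-space that is implied by $H$; the $H$-free extension complexity of $Q$ is $\mathrm{xc}(Q_H)$. Let $H(G)$ be the set of odd-set inequalities $$\sum_{e\in E,\ e\subseteq S}x_e\le\frac{|S|-1}{2},\qquad S\subseteq V,\ |S|\text{ odd}.$$ Theorem. (1) There are constants $C\in\mathbb{N}$ and $c>0$ such that for every integer $n\ge 1$ there is a bipartite graph $G$ with at most $Cn$ vertices and at most $Cn$ edges such that $$\mathrm{xc}(Q(G))\ \ge\ 2^{c\,n^{1/4}}\qquad\text{and}\qquad \mathrm{xc}\bigl(Q(G)_{H(G)}\bigr)\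 \ge\ 2^{c\,n^{1/4}}.$$ In particular, the $H$-free extension complexity of the induced matching polytope with respect to the odd-set inequalities is super-polynomial in the worst case, even for bipartite graphs. (2) For every bipartite graph $G=(V,E)$ the inequalities $x_e\ge 0$ ($e\in E$) and $\sum_{e\ni v}x_e\le 1$ ($v\in V$) are valid for $Q(G)$, and together they imply every odd-set inequality in $H(G)$; in this sense the odd-set inequalities are redundant for bipartite graphs. -/

import Mathlib

open scoped ENNReal

namespace HFree

section Polyhedra

variable {E : Type*} [AddCommGroup E] [Module ℝ E]

/-- A linear inequality `a x ≤ b` on the real vector space `E`, stored as the pair `(a, b)`. -/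
abbrev LinIneq (E : Type*) [AddCommGroup E] [Module ℝ E] : Type _ := Module.Dual ℝ E × ℝ

/-- The half-space of all points satisfying one inequality. -/
def halfSpace (h : LinIneq E) : Set E := {x | h.1 x ≤ h.2}

/-- The set of all points satisfying every inequality of `H`; it is all of `E` if `H` is empty. -/
def solutionSet (H : Set (LinIneq E)) : Set E := {x | ∀ h ∈ H, x ∈ halfSpace h}

/-- A (convex) polyhedron: the solution set of finitely many linear inequalities. -/
def IsPolyhedron (P : Set E) : Prop := ∃ H : Set (LinIneq E), H.Finite ∧ P = solutionSet H

variable [TopologicalSpace E]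

/-- A facet of `P`: an inclusion-maximal element among the nonempty proper (exposed) faces of `P`. -/
def IsFacet (P F : Set E) : Prop :=
  Maximal (fun B : Set E => B.Nonempty ∧ IsExposed ℝ P B ∧ B ≠ P) F

/-- The number of facets of `P`. -/
noncomputable def numFacets (P : Set E) : ℕ∞ := {F : Set E | IsFacet P F}.encard

/-- The extension complexity of `Q`: the least number of facets of a polyhedron `P`
(in a space `ℝ ^ d` of any dimension) of which `Q` is the image under a linear map.
The polyhedron `P` is not required to be bounded, since `Q` itself may be unbounded; for a polytope
`Q` the minimum is the same as over bounded `P`. -/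
noncomputable def extensionComplexity (Q : Set E) : ℕ∞ :=
  ⨅ (d : ℕ) (P : Set (Fin d → ℝ)) (_ : IsPolyhedron P)
    (π : (Fin d → ℝ) →ₗ[ℝ] E) (_ : π '' P = Q), numFacets P

/-- The non-redundant half-space representation of a full-dimensional polytope `Q`: all the
inequalities that are valid for `Q` and hold with equality exactly on a facet of `Q`.
Each facet gives one half-space; its inequality is unique up to positive scaling. -/
def facetInequalities (Q : Set E) : Set (LinIneq E) :=
  {h | Q ⊆ halfSpace h ∧ IsFacet Q {x ∈ Q | h.1 x = h.2}}

/-- The polyhedron `Q_H` of a full-dimensional polytope `Q` and a set `H` of valid inequalities: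
delete from the non-redundant half-space representation of `Q` all half-spaces that are implied
by `H`. -/
def residualPolyhedron (H : Set (LinIneq E)) (Q : Set E) : Set E :=
  solutionSet {h ∈ facetInequalities Q | ¬ solutionSet H ⊆ halfSpace h}

/-- The `H`-free extension complexity of `Q`. -/
noncomputable def hFreeExtensionComplexity (H : Set (LinIneq E)) (Q : Set E) : ℕ∞ :=
  extensionComplexity (residualPolyhedron H Q)

end Polyhedra

section Graphs

variable {V : Type*} (G : SimpleGraph V)

/-- The 0/1 incidence vector, indexed by the edges of `G`, of the edge set of a subgraph. -/
noncomputable def incidenceVector (M : G.Subgraph) : G.edgeSet → ℝ :=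
  fun e => M.edgeSet.indicator 1 (e : Sym2 V)

/-- The convex hull of the incidence vectors of all induced matchings of `G`; an induced matching
is a matching `M` such that every edge of `G` between vertices covered by `M` belongs to `M`.
It contains the origin and all unit vectors, so it is full-dimensional. -/
def inducedMatchingPolytope : Set (G.edgeSet → ℝ) :=
  convexHull ℝ {x | ∃ M : G.Subgraph, M.IsMatching ∧ M.IsInduced ∧ x = incidenceVector G M}

open Classical in
/-- The linear form `x ↦ ∑ x_e`, summed over all edges `e` with both endpoints in `S`. -/
noncomputable def sumInside [Fintype V] (S : Finset V) : Module.Dual ℝ (G.edgeSet → ℝ) :=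
  ∑ e ∈ Finset.univ.filter (fun e : G.edgeSet => ∀ v ∈ e.1, v ∈ S),
    LinearMap.proj e

open Classical in
/-- The linear form `x ↦ ∑ x_e`, summed over all edges `e` incident with `v`. -/
noncomputable def sumAt [Fintype V] (v : V) : Module.Dual ℝ (G.edgeSet → ℝ) :=
  ∑ e ∈ Finset.univ.filter (fun e : G.edgeSet => v ∈ e.1),
    LinearMap.proj e

/-- The odd-set inequalities `∑_{e ⊆ S} x_e ≤ (|S| - 1) / 2`, for vertex sets `S` of odd size. -/
def oddSetInequalities [Fintype V] : Set (LinIneq (G.edgeSet → ℝ)) :=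
  {h | ∃ S : Finset V, Odd S.card ∧ h = (sumInside G S, ((S.card : ℝ) - 1) / 2)}

/-- The nonnegativity inequalities `-x_e ≤ 0` for all edges `e` and the degree inequalities
`∑_{e ∋ v} x_e ≤ 1` for all vertices `v`. -/
def degreeInequalities [Fintype V] : Set (LinIneq (G.edgeSet → ℝ)) :=
  {h | (∃ e : G.edgeSet, h = (-LinearMap.proj e, 0)) ∨ ∃ v : V, h = (sumAt G v, 1)}

end Graphs

end HFree

/-! The lower bounds come from unique disjointness. In the gadget graph every subset `a` of `Fin k`
yields an induced matching, and every subset `b` yields a valid inequality whose slack there is (1 -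
|a ∩ b|)²: zero if |a ∩ b| = 1, positive if a and b are disjoint. Let the polytope be a linear image
of a polyhedron P. Since a nonempty face of P is the intersection of the facets containing it
(`IsPolyhedron.exists_isFacet`), each disjoint pair (a, b) with b nonempty has a facet that misses
the chosen preimage of a and contains those of all a' with |a' ∩ b| = 1. The pairs served in this
way by one facet lie in a rectangle without pairs of overlap one, which holds at most 2^k of the 3^k
disjoint pairs (`sum_rectangle_le`). Hence about (3/2)^k facets are needed, for a graph with O(k²)
vertices and edges.

Deleting the facets implied by the odd-set inequalities hardly helps. Each separating inequality can
be replaced by a facet-defining one that still separates (`exists_mem_facetInequalities`). Either it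
survives in the residual polyhedron, or it is implied by the odd-set inequalities and so, by
bipartiteness, by the degree inequalities; then one of those already separates the pair
(`exists_ineq_tight`). This costs only O(k²) further rectangles. -/

namespace HFree

/-! ### Faces and facets of polyhedra and polytopes -/

section FaceTheory

variable {E : Type*} [AddCommGroup E] [Module ℝ E]

theorem convex_solutionSet (H : Set (LinIneq E)) : Convex ℝ (solutionSet H) := by
  intro x hx y hy s t hs ht hst h hh
  have h1 := hx h hh
  have h2 := hy h hh
  simp only [halfSpace, Set.mem_ofPred_eq, map_add, map_smul, smul_eq_mul] at *
  calc s * h.1 x + t * h.1 y ≤ s * h.2 + t * h.2 := by gcongr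
    _ = h.2 := by rw [← add_mul, hst, one_mul]

/-- A nonempty convex set satisfying finitely many inequalities has a point at which every
inequality that is not tight on the whole set is strict. -/
theorem exists_mem_forall_strict {H : Set (LinIneq E)} (hH : H.Finite) {S : Set E}
    (hS : Convex ℝ S) (hne : S.Nonempty) (hval : S ⊆ solutionSet H) :
    ∃ s ∈ S, ∀ h ∈ H, (∃ y ∈ S, h.1 y < h.2) → h.1 s < h.2 := by
  induction H, hH using Set.Finite.induction_on with
  | empty => exact ⟨hne.some, hne.some_mem, by simp⟩
  | @insert g H _ _ ih =>
    obtain ⟨s, hs, hs'⟩ := ih fun x hx h hh => hval hx h (Set.mem_insert_of_mem _ hh)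
    by_cases hg : ∃ y ∈ S, g.1 y < g.2
    · obtain ⟨y, hy, hgy⟩ := hg
      refine ⟨(1 / 2 : ℝ) • s + (1 / 2 : ℝ) • y,
        hS hs hy (by norm_num) (by norm_num) (by norm_num), fun h hh hex => ?_⟩
      have h1 : h.1 s ≤ h.2 := hval hs h hh
      have h2 : h.1 y ≤ h.2 := hval hy h hh
      simp only [map_add, map_smul, smul_eq_mul]
      rcases Set.mem_insert_iff.1 hh with rfl | hh
      · linarith
      · linarith [hs' h hh hex]
    · refine ⟨s, hs, fun h hh hex => ?_⟩
      rcases Set.mem_insert_iff.1 hh with rfl | hh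
      · exact absurd hex hg
      · exact hs' h hh hex

/-- If an inequality valid for a polyhedron is tight on a nonempty convex subset and strict at a
point, then so is one of the inequalities describing the polyhedron. -/
theorem exists_ineq_tight {H : Set (LinIneq E)} (hH : H.Finite) {f : LinIneq E}
    (hf : solutionSet H ⊆ halfSpace f) {S : Set E} (hS : Convex ℝ S) (hne : S.Nonempty)
    (hsub : S ⊆ solutionSet H) (htight : ∀ x ∈ S, f.1 x = f.2) {p : E} (hp : p ∈ solutionSet H)
    (hfp : f.1 p < f.2) : ∃ h ∈ H, (∀ x ∈ S, h.1 x = h.2) ∧ h.1 p < h.2 := by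
  by_contra! hcon
  obtain ⟨s, hs, hstrict⟩ := exists_mem_forall_strict hH hS hne hsub
  -- Go from `p` to the relatively interior point `s` and slightly beyond. If every inequality tight
  -- on `S` were tight at `p` too, the new point would stay in the polyhedron, yet it violates `f`.
  have key : ∀ᶠ t in nhdsWithin (0 : ℝ) (Set.Ioi 0), ∀ h ∈ H, h.1 (s + t • (s - p)) ≤ h.2 := by
    rw [hH.eventually_all]
    intro h hh
    by_cases hx : ∃ y ∈ S, h.1 y < h.2
    · have h1 := hstrict h hh hx
      have : Filter.Tendsto (fun t : ℝ => h.1 s + t * (h.1 s - h.1 p))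
          (nhdsWithin (0 : ℝ) (Set.Ioi 0)) (nhds (h.1 s + 0 * (h.1 s - h.1 p))) :=
        (Continuous.tendsto (by fun_prop) _).mono_left nhdsWithin_le_nhds
      filter_upwards [this.eventually (gt_mem_nhds (by simpa using h1))] with t ht
      simpa using ht.le
    · push Not at hx
      have hxe : ∀ y ∈ S, h.1 y = h.2 := fun y hy => le_antisymm (hsub hy h hh) (hx y hy)
      filter_upwards with t
      have h1 := hxe s hs
      have h2 : h.1 p = h.2 := le_antisymm (hp h hh) (hcon h hh hxe)
      simp [h1, h2]
  obtain ⟨t, ht, ht0⟩ := (key.and self_mem_nhdsWithin).exists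
  have h1 : f.1 (s + t • (s - p)) ≤ f.2 := hf ht
  have h2 := htight s hs
  simp only [map_add, map_smul, map_sub, smul_eq_mul, h2] at h1
  have : 0 < t * (f.2 - f.1 p) := mul_pos ht0 (by linarith)
  linarith

/-- Every polyhedron has a finite description without redundant inequalities. -/
theorem IsPolyhedron.exists_irredundant {P : Set E} (hP : IsPolyhedron P) :
    ∃ H : Set (LinIneq E), H.Finite ∧ P = solutionSet H ∧
      ∀ h ∈ H, ∃ z ∈ solutionSet (H \ {h}), h.2 < h.1 z := by
  obtain ⟨H, ⟨hfin, hP'⟩, hmin⟩ := exists_minimalFor_of_wellFoundedLT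
    (fun H : Set (LinIneq E) => H.Finite ∧ P = solutionSet H) Set.ncard hP
  refine ⟨H, hfin, hP', fun h hh => ?_⟩
  by_contra! hcon
  have hlt := Set.ncard_sdiff_singleton_lt_of_mem hh hfin
  refine absurd (hmin ⟨hfin.sdiff, ?_⟩ hlt.le) hlt.not_ge
  rw [hP']
  refine subset_antisymm (fun x hx g hg => hx g hg.1) fun x hx g hg => ?_
  by_cases hgh : g = h
  · exact hgh ▸ hcon x hx
  · exact hx g ⟨hg, hgh⟩

theorem convexHull_subset_halfSpace {X : Set E} {h : LinIneq E} (hX : X ⊆ halfSpace h) :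
    convexHull ℝ X ⊆ halfSpace h :=
  convexHull_min hX ((convex_Iic h.2).linear_preimage h.1)

variable [TopologicalSpace E]

/-- An exposed face that is not everything is the tight set of a valid inequality. -/
theorem exists_ineq_of_isExposed {P B : Set E} (hB : IsExposed ℝ P B) (hne : B.Nonempty) :
    ∃ f : LinIneq E, P ⊆ halfSpace f ∧ B = {x ∈ P | f.1 x = f.2} := by
  obtain ⟨l, hl⟩ := hB hne
  obtain ⟨y, hy⟩ := hne
  have hy' : y ∈ P ∧ ∀ z ∈ P, l z ≤ l y := by rw [hl] at hy; exact hy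
  refine ⟨(l.toLinearMap, l y), fun x hx => hy'.2 x hx, ?_⟩
  rw [hl]
  ext x
  refine and_congr_right fun hx => ⟨fun h => ?_, fun h z hz => ?_⟩
  · exact le_antisymm (hy'.2 x hx) (h y hy'.1)
  · exact (hy'.2 z hz).trans_eq h.symm

variable [IsTopologicalAddGroup E] [ContinuousSMul ℝ E] [T2Space E]
  [FiniteDimensional ℝ E]

theorem isExposed_setOf_tight {P : Set E} {h : LinIneq E} (hval : P ⊆ halfSpace h) :
    IsExposed ℝ P {x ∈ P | h.1 x = h.2} := by
  rintro ⟨y, hyP, hy⟩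
  refine ⟨LinearMap.toContinuousLinearMap h.1, ?_⟩
  ext x
  refine and_congr_right fun hx => ⟨fun hxe z hz => ?_, fun hxe => ?_⟩
  · exact (hval hz).trans_eq hxe.symm
  · exact le_antisymm (hval hx) (hy.symm.trans_le (hxe y hyP))

/-- In a polyhedron, every nonempty face is the intersection of the facets containing it. -/
theorem IsPolyhedron.exists_isFacet {P : Set E} (hP : IsPolyhedron P) {f : LinIneq E}
    (hf : P ⊆ halfSpace f) (hne : ∃ x ∈ P, f.1 x = f.2) {p : E} (hp : p ∈ P)
    (hfp : f.1 p < f.2) : ∃ F, IsFacet P F ∧ (∀ x ∈ P, f.1 x = f.2 → x ∈ F) ∧ p ∉ F := by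
  obtain ⟨H, hfin, rfl, hirr⟩ := hP.exists_irredundant
  have hconv : ∀ f : LinIneq E, Convex ℝ {x ∈ solutionSet H | f.1 x = f.2} := fun f =>
    (convex_solutionSet H).inter ((convex_singleton f.2).linear_preimage f.1)
  have hne' : {x ∈ solutionSet H | f.1 x = f.2}.Nonempty := hne
  obtain ⟨h, hh, htight, hhp⟩ := exists_ineq_tight hfin hf (hconv f) hne' (fun x hx => hx.1)
    (fun x hx => hx.2) hp hfp
  have hhval : solutionSet H ⊆ halfSpace h := fun x hx => hx h hh
  refine ⟨{x ∈ solutionSet H | h.1 x = h.2}, ⟨⟨?_, isExposed_setOf_tight hhval, ?_⟩, ?_⟩,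
    fun x hx hfx => ⟨hx, htight x ⟨hx, hfx⟩⟩, fun hmem => hhp.ne hmem.2⟩
  · obtain ⟨x, hx, hfx⟩ := hne
    exact ⟨x, hx, htight x ⟨hx, hfx⟩⟩
  · intro heq
    have : p ∈ {x ∈ solutionSet H | h.1 x = h.2} := heq.symm ▸ hp
    exact hhp.ne this.2
  · rintro B ⟨hBne, hBexp, hBP⟩ hFB
    obtain ⟨m, hm, rfl⟩ := exists_ineq_of_isExposed hBexp hBne
    obtain ⟨q, hq, hmq⟩ : ∃ q ∈ solutionSet H, m.1 q < m.2 := by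
      by_contra! hcon
      exact hBP (Set.Subset.antisymm (fun x hx => hx.1)
        fun x hx => ⟨hx, le_antisymm (hm hx) (hcon x hx)⟩)
    obtain ⟨g, hg, hgtight, hgq⟩ := exists_ineq_tight hfin hm (hconv m) hBne (fun x hx => hx.1)
      (fun x hx => hx.2) hq hmq
    -- If `g ≠ h`, take `z` violating only `h` and `w` strict for both. The segment from `w` to `z`
    -- meets the hyperplane of `h` inside the polyhedron, at a point where `g` is strict, although
    -- `g` is tight on the whole face of `h`.
    suffices hgh : g = h from fun x hx => ⟨hx.1, hgh ▸ hgtight x hx⟩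
    by_contra hgh
    obtain ⟨z, hz, hhz⟩ := hirr h hh
    set w : E := (1 / 2 : ℝ) • p + (1 / 2 : ℝ) • q with hw
    have hwH : w ∈ solutionSet H :=
      convex_solutionSet H hp hq (by norm_num) (by norm_num) (by norm_num)
    have hgp : g.1 p ≤ g.2 := hp g hg
    have hhq : h.1 q ≤ h.2 := hq h hh
    have hgw : g.1 w < g.2 := by
      simp only [hw, map_add, map_smul, smul_eq_mul]; linarith
    have hhw : h.1 w < h.2 := by
      simp only [hw, map_add, map_smul, smul_eq_mul]; linarith
    have hden : 0 < h.1 z - h.1 w := by linarith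
    set t : ℝ := (h.2 - h.1 w) / (h.1 z - h.1 w) with ht
    have ht0 : 0 < t := div_pos (by linarith) hden
    have ht1 : t < 1 := (div_lt_one hden).2 (by linarith)
    have htm : t * (h.1 z - h.1 w) = h.2 - h.1 w := div_mul_cancel₀ _ hden.ne'
    have hu : h.1 ((1 - t) • w + t • z) = h.2 := by
      simp only [map_add, map_smul, smul_eq_mul]; linarith
    have huH : (1 - t) • w + t • z ∈ solutionSet H := by
      intro h' hh'
      by_cases hhh : h' = h
      · subst hhh; exact hu.le
      · exact convex_solutionSet (H \ {h}) (fun k hk => hwH k hk.1) hz (by linarith) ht0.le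
          (by ring) h' ⟨hh', hhh⟩
    have hgu := hgtight _ (hFB ⟨huH, hu⟩)
    have hgz : g.1 z ≤ g.2 := hz g ⟨hg, hgh⟩
    simp only [map_add, map_smul, smul_eq_mul] at hgu
    have h1 := mul_lt_mul_of_pos_left hgw (sub_pos.2 ht1)
    have h2 := mul_le_mul_of_nonneg_left hgz ht0.le
    linarith

/-- In a polytope, every face is cut out by facet-defining inequalities. -/
theorem exists_mem_facetInequalities {X : Set E} (hX : X.Finite) {f : LinIneq E}
    (hf : X ⊆ halfSpace f) (hne : ∃ x ∈ X, f.1 x = f.2) {p : E} (hp : p ∈ X)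
    (hfp : f.1 p < f.2) : ∃ h ∈ facetInequalities (convexHull ℝ X),
      (∀ x ∈ X, f.1 x = f.2 → h.1 x = h.2) ∧ h.1 p < h.2 := by
  have hsX : X ⊆ convexHull ℝ X := subset_convexHull ℝ X
  let T : LinIneq E → Set E := fun h => {x ∈ X | h.1 x = h.2}
  -- Among the valid inequalities strict at `p` and tight wherever `f` is, one with the largest set
  -- of tight points of `X` defines a facet.
  obtain ⟨h, ⟨hhX, hfh, hhp⟩, hmax⟩ : ∃ h, MaximalFor
      (fun h : LinIneq E => X ⊆ halfSpace h ∧ T f ⊆ T h ∧ h.1 p < h.2) T h := by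
    refine Set.Finite.exists_maximalFor' T _ (hX.finite_subsets.subset ?_)
      ⟨f, hf, subset_rfl, hfp⟩
    rintro _ ⟨h, -, rfl⟩
    exact fun x hx => hx.1
  have hmax' : ∀ g : LinIneq E, X ⊆ halfSpace g → T h ⊆ T g → g.1 p < g.2 → T g ⊆ T h :=
    fun g hg hT hgp => hmax ⟨hg, hfh.trans hT, hgp⟩ hT
  have hval := convexHull_subset_halfSpace hhX
  refine ⟨h, ⟨hval, ⟨?_, isExposed_setOf_tight hval, ?_⟩, ?_⟩,
    fun x hx hfx => (hfh ⟨hx, hfx⟩).2, hhp⟩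
  · obtain ⟨x, hx, hfx⟩ := hne
    exact ⟨x, hsX hx, (hfh ⟨hx, hfx⟩).2⟩
  · intro heq
    have : p ∈ {x ∈ convexHull ℝ X | h.1 x = h.2} := heq.symm ▸ hsX hp
    exact hhp.ne this.2
  rintro B ⟨hBne, hBexp, hBP⟩ hFB
  obtain ⟨m, hm, rfl⟩ := exists_ineq_of_isExposed hBexp hBne
  have hmX : X ⊆ halfSpace m := hsX.trans hm
  have hTm : T h ⊆ T m := fun x hx => ⟨hx.1, (hFB ⟨hsX hx.1, hx.2⟩).2⟩
  -- Were `m` tight at `p`, subtracting a multiple of `m` from `h` would leave the slack at `p`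
  -- unchanged. The minimum ratio `t` keeps the result valid and makes it tight at a new point `v`,
  -- against maximality.
  have hmp : m.1 p < m.2 := by
    by_contra hmp
    have hmp : m.1 p = m.2 := le_antisymm (hmX hp) (not_lt.1 hmp)
    have hYne : {x ∈ X | m.1 x < m.2}.Nonempty := by
      by_contra hcon
      have : X ⊆ {x | m.1 x = m.2} := fun x hx =>
        le_antisymm (hmX hx) (not_lt.1 fun hlt => hcon ⟨x, hx, hlt⟩)
      have := convexHull_min this ((convex_singleton m.2).linear_preimage m.1)
      exact hBP (Set.Subset.antisymm (fun x hx => hx.1) fun x hx => ⟨hx, this hx⟩)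
    obtain ⟨v, ⟨hvX, hmv⟩, hvmin⟩ := Set.exists_min_image {x ∈ X | m.1 x < m.2}
      (fun x => (h.2 - h.1 x) / (m.2 - m.1 x)) (hX.subset fun x hx => hx.1) hYne
    set t := (h.2 - h.1 v) / (m.2 - m.1 v) with ht
    have hhv : h.1 v ≤ h.2 := hhX hvX
    have ht0 : 0 ≤ t := div_nonneg (by linarith) (by linarith)
    have htv : t * (m.2 - m.1 v) = h.2 - h.1 v := div_mul_cancel₀ _ (by linarith)
    have hle := hmax' (h.1 - t • m.1, h.2 - t * m.2) ?_ ?_ ?_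
    · have hv : v ∈ T h := by
        refine hle ⟨hvX, ?_⟩
        simp only [LinearMap.sub_apply, LinearMap.smul_apply, smul_eq_mul]
        linarith
      exact hmv.ne (hTm hv).2
    · intro x hx
      simp only [halfSpace, Set.mem_ofPred_eq, LinearMap.sub_apply, LinearMap.smul_apply,
        smul_eq_mul]
      have h1 : h.1 x ≤ h.2 := hhX hx
      rcases (show m.1 x ≤ m.2 from hmX hx).eq_or_lt with hmx | hmx
      · rw [hmx]; linarith
      · have := (le_div_iff₀ (by linarith)).1 (hvmin x ⟨hx, hmx⟩)
        linarith
    · rintro x hx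
      refine ⟨hx.1, ?_⟩
      simp only [LinearMap.sub_apply, LinearMap.smul_apply, smul_eq_mul, hx.2, (hTm hx).2]
    · simp only [LinearMap.sub_apply, LinearMap.smul_apply, smul_eq_mul, hmp]
      linarith
  have hTeq := hmax' m hmX hTm hmp
  -- Now `m` and `h` have the same tight points in the finite set `X`, so a small multiple of the
  -- slack of `h` is below the slack of `m`, first on `X` and then on its hull.
  obtain ⟨ε, hε, hε0⟩ : ∃ ε : ℝ, (∀ x ∈ X, ε * (h.2 - h.1 x) ≤ m.2 - m.1 x) ∧ 0 < ε := by
    have key : ∀ᶠ t in nhdsWithin (0 : ℝ) (Set.Ioi 0), ∀ x ∈ X,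
        t * (h.2 - h.1 x) ≤ m.2 - m.1 x := by
      rw [hX.eventually_all]
      intro x hx
      rcases (show m.1 x ≤ m.2 from hmX hx).eq_or_lt with hmx | hmx
      · filter_upwards with t
        simp [hmx, (hTeq ⟨hx, hmx⟩).2]
      · have : Filter.Tendsto (fun t : ℝ => t * (h.2 - h.1 x))
            (nhdsWithin (0 : ℝ) (Set.Ioi 0)) (nhds (0 * (h.2 - h.1 x))) :=
          (Continuous.tendsto (by fun_prop) _).mono_left nhdsWithin_le_nhds
        filter_upwards [this.eventually (gt_mem_nhds
          (show 0 * (h.2 - h.1 x) < m.2 - m.1 x by linarith))] with t ht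
        exact ht.le
    exact (key.and self_mem_nhdsWithin).exists
  have hQ : convexHull ℝ X ⊆ halfSpace (m.1 - ε • h.1, m.2 - ε * h.2) := by
    refine convexHull_subset_halfSpace fun x hx => ?_
    simp only [halfSpace, Set.mem_ofPred_eq, LinearMap.sub_apply, LinearMap.smul_apply,
      smul_eq_mul]
    linarith [hε x hx]
  rintro y ⟨hy, hmy⟩
  refine ⟨hy, le_antisymm (hval hy) (not_lt.1 fun hlt => ?_)⟩
  have h1 := hQ hy
  simp only [halfSpace, Set.mem_ofPred_eq, LinearMap.sub_apply, LinearMap.smul_apply,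
    smul_eq_mul, hmy] at h1
  nlinarith [mul_pos hε0 (sub_pos.2 hlt)]

end FaceTheory
-- Rectangle covers for unique disjointness
section Rectangles

/-- The size of the intersection of two subsets of `Fin k`, given as Boolean vectors. -/
def overlap {k : ℕ} (a b : Fin k → Bool) : ℕ := ∑ i, if a i ∧ b i then 1 else 0

theorem overlap_cons {k : ℕ} (x y : Bool) (a b : Fin k → Bool) :
    overlap (Fin.cons x a : Fin (k + 1) → Bool) (Fin.cons y b) =
      (if x ∧ y then 1 else 0) + overlap a b := by
  simp only [overlap, Fin.sum_univ_succ, Fin.cons_zero, Fin.cons_succ]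

theorem sum_fin_succ_bool {k : ℕ} (f : (Fin (k + 1) → Bool) → ℕ) :
    ∑ a, f a = ∑ a, f (Fin.cons false a) + ∑ a, f (Fin.cons true a) := by
  rw [← (Fin.consEquiv fun _ : Fin (k + 1) => Bool).sum_comp f, Fintype.sum_prod_type,
    Fintype.sum_bool, add_comm]
  rfl

/-- Each coordinate of a disjoint pair allows three of the four bit patterns. -/
theorem sum_overlap_eq_zero (k : ℕ) :
    ∑ a : Fin k → Bool, ∑ b : Fin k → Bool, (if overlap a b = 0 then 1 else 0) = 3 ^ k := by
  induction k with
  | zero => simp [overlap]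
  | succ k ih =>
    simp only [sum_fin_succ_bool, overlap_cons, ← Finset.sum_add_distrib]
    rw [pow_succ, ← ih, Finset.sum_mul]
    refine Finset.sum_congr rfl fun a _ => ?_
    rw [Finset.sum_mul]
    refine Finset.sum_congr rfl fun b _ => ?_
    by_cases h : overlap a b = 0 <;> simp [h]

open Classical in
/-- A combinatorial rectangle without pairs of overlap one contains at most `2 ^ k` disjoint
pairs. -/
theorem sum_rectangle_le {k : ℕ} (A B : (Fin k → Bool) → Prop)
    (h : ∀ a b, A a → B b → overlap a b ≠ 1) :
    ∑ a, ∑ b, (if A a ∧ B b ∧ overlap a b = 0 then 1 else 0) ≤ 2 ^ k := by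
  induction k with
  | zero =>
    simp only [Finset.univ_unique, Finset.sum_singleton, pow_zero]
    split_ifs <;> simp
  | succ k ih =>
    let A₀ : (Fin k → Bool) → Prop := fun a => A (Fin.cons false a)
    let A₁ : (Fin k → Bool) → Prop := fun a => A (Fin.cons true a)
    let B₀ : (Fin k → Bool) → Prop := fun b => B (Fin.cons false b)
    let B₁ : (Fin k → Bool) → Prop := fun b => B (Fin.cons true b)
    have h00 : ∀ a b, A₀ a → B₀ b → overlap a b ≠ 1 := fun a b ha hb => by
      simpa [overlap_cons] using h _ _ ha hb
    have h10 : ∀ a b, A₁ a → B₀ b → overlap a b ≠ 1 := fun a b ha hb => by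
      simpa [overlap_cons] using h _ _ ha hb
    have h01 : ∀ a b, A₀ a → B₁ b → overlap a b ≠ 1 := fun a b ha hb => by
      simpa [overlap_cons] using h _ _ ha hb
    have h11 : ∀ a b, A₁ a → B₁ b → overlap a b ≠ 0 := fun a b ha hb => by
      simpa [overlap_cons] using h _ _ ha hb
    -- Split on the first bits. As (1,1) contributes no disjoint pair, the projections (A₀ ∪ A₁) ×
    -- B₀ and A₀ × (B₀ ∪ B₁) account for the other three cases. Both still avoid overlap one,
    -- because one of the first bits is 0.
    have i1 := ih (fun a => A₀ a ∨ A₁ a) B₀ fun a b ha hb =>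
      ha.elim (fun ha => h00 a b ha hb) fun ha => h10 a b ha hb
    have i2 := ih A₀ (fun b => B₀ b ∨ B₁ b) fun a b ha hb =>
      hb.elim (fun hb => h00 a b ha hb) fun hb => h01 a b ha hb
    rw [pow_succ, mul_two]
    refine le_trans ?_ (add_le_add i1 i2)
    simp only [sum_fin_succ_bool, overlap_cons, ← Finset.sum_add_distrib]
    refine Finset.sum_le_sum fun a _ => Finset.sum_le_sum fun b _ => ?_
    have h11' := h11 a b
    change (((if A₀ a ∧ B₀ b ∧ _ then 1 else 0) + (if A₀ a ∧ B₁ b ∧ _ then 1 else 0) +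
      ((if A₁ a ∧ B₀ b ∧ _ then 1 else 0) + (if A₁ a ∧ B₁ b ∧ _ then 1 else 0)) : ℕ) ≤ _)
    by_cases h0 : overlap a b = 0
    · by_cases hA0 : A₀ a <;> by_cases hA1 : A₁ a <;> by_cases hB0 : B₀ b <;>
        by_cases hB1 : B₁ b <;> simp_all
    · simp [h0]

open Classical in
/-- The nondeterministic lower bound for unique disjointness. -/
theorem three_pow_le_card_mul {k : ℕ} {ι : Type*} [Fintype ι]
    (A B : ι → (Fin k → Bool) → Prop)
    (h : ∀ i a b, A i a → B i b → overlap a b ≠ 1)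
    (hcov : ∀ a b, overlap a b = 0 → ∃ i, A i a ∧ B i b) :
    3 ^ k ≤ Fintype.card ι * 2 ^ k := by
  calc 3 ^ k = ∑ a : Fin k → Bool, ∑ b : Fin k → Bool, (if overlap a b = 0 then 1 else 0) :=
        (sum_overlap_eq_zero k).symm
    _ ≤ ∑ a : Fin k → Bool, ∑ b : Fin k → Bool,
          ∑ i, (if A i a ∧ B i b ∧ overlap a b = 0 then 1 else 0) := by
        refine Finset.sum_le_sum fun a _ => Finset.sum_le_sum fun b _ => ?_
        split_ifs with h0
        · obtain ⟨i, hA, hB⟩ := hcov a b h0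
          refine le_trans ?_ (Finset.single_le_sum (fun _ _ => Nat.zero_le _)
            (Finset.mem_univ i))
          simp [hA, hB, h0]
        · exact Nat.zero_le _
    _ = ∑ i, ∑ a, ∑ b, (if A i a ∧ B i b ∧ overlap a b = 0 then 1 else 0) :=
        (Finset.sum_congr rfl fun a _ => Finset.sum_comm).trans Finset.sum_comm
    _ ≤ ∑ _i : ι, 2 ^ k := Finset.sum_le_sum fun i _ => sum_rectangle_le _ _ (h i)
    _ = Fintype.card ι * 2 ^ k := by simp

end Rectangles

/-! ### From separating inequalities to extension complexity -/

section ExtensionBound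

variable {E : Type*} [AddCommGroup E] [Module ℝ E]

/-- The inequality `h` separates `x a` from all the points `x a'` with `overlap a' b = 1`,
on which it is tight. -/
def Separates {k : ℕ} (x : (Fin k → Bool) → E) (h : LinIneq E) (a b : Fin k → Bool) : Prop :=
  (∀ a', overlap a' b = 1 → h.1 (x a') = h.2) ∧ h.1 (x a) < h.2

/-- A lower bound on extension complexity from unique disjointness: up to the additional
inequalities `g j`, every disjoint pair is separated by an inequality that is valid for `R`. -/
theorem le_extensionComplexity {k L : ℕ} {J : Type*} [Fintype J] {R : Set E}
    (x : (Fin k → Bool) → E) (hx : ∀ a, x a ∈ R) (g : J → LinIneq E)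
    (hsep : ∀ a b, overlap a b = 0 → (∃ h, R ⊆ halfSpace h ∧ (∃ a', overlap a' b = 1) ∧
      Separates x h a b) ∨ ∃ j, Separates x (g j) a b)
    (hL : (L + Fintype.card J) * 2 ^ k < 3 ^ k) : (L : ℕ∞) ≤ extensionComplexity R := by
  refine le_iInf fun d => le_iInf fun P => le_iInf fun hP => le_iInf fun π => le_iInf fun hπ => ?_
  by_contra! hlt
  have hfin : {F : Set (Fin d → ℝ) | IsFacet P F}.Finite :=
    Set.encard_lt_top_iff.1 (hlt.trans (ENat.natCast_lt_top L))
  have : Fintype {F : Set (Fin d → ℝ) | IsFacet P F} := hfin.fintype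
  have hcard : Fintype.card {F : Set (Fin d → ℝ) | IsFacet P F} < L := by
    rw [numFacets, Set.encard_eq_coe_toFinset_card, Set.toFinset_card] at hlt
    exact_mod_cast hlt
  choose p hpP hpx using fun a => (hπ ▸ hx a : x a ∈ π '' P)
  -- One rectangle per facet and one per additional inequality: the rows are strict there, and the
  -- columns are those `b` for which every `a'` of overlap one is tight.
  have key := three_pow_le_card_mul (k := k) (ι := {F : Set (Fin d → ℝ) | IsFacet P F} ⊕ J)
    (Sum.elim (fun F a => p a ∉ F.1) fun j a => (g j).1 (x a) < (g j).2)
    (Sum.elim (fun F b => ∀ a', overlap a' b = 1 → p a' ∈ F.1)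
      fun j b => ∀ a', overlap a' b = 1 → (g j).1 (x a') = (g j).2) ?_ ?_
  · rw [Fintype.card_sum] at key
    have := key.trans (Nat.mul_le_mul_right (2 ^ k)
      (Nat.add_le_add_right hcard.le (Fintype.card J)))
    omega
  · rintro (F | j) a b hA hB h1
    · exact hA (hB a h1)
    · exact hA.ne (hB a h1)
  · intro a b h0
    rcases hsep a b h0 with ⟨h, hR, ⟨a₁, ha₁⟩, htight, hlt'⟩ | ⟨j, htight, hlt'⟩
    · obtain ⟨F, hF, hFsub, hpF⟩ := hP.exists_isFacet (f := (h.1 ∘ₗ π, h.2))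
        (fun y hy => hR (hπ ▸ Set.mem_image_of_mem π hy))
        ⟨p a₁, hpP a₁, by simpa [hpx] using htight a₁ ha₁⟩ (hpP a) (by simpa [hpx] using hlt')
      exact ⟨Sum.inl ⟨F, hF⟩, hpF, fun a' ha' =>
        hFsub _ (hpP a') (by simpa [hpx] using htight a' ha')⟩
    · exact ⟨Sum.inr j, hlt', htight⟩

theorem le_extensionComplexity_convexHull {k L : ℕ} {X : Set E}
    (x : (Fin k → Bool) → E) (hx : ∀ a, x a ∈ X)
    (hsep : ∀ a b, overlap a b = 0 → ∃ h, X ⊆ halfSpace h ∧ Separates x h a b)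
    (hL : (L + 1) * 2 ^ k < 3 ^ k) :
    (L : ℕ∞) ≤ extensionComplexity (convexHull ℝ X) := by
  -- The constant inequality 0 ≤ 1, strict everywhere, serves the empty `b`: no `a'` meets it in one
  -- element, so its inequality need not define a nonempty face.
  refine le_extensionComplexity (J := Unit) x (fun a => subset_convexHull ℝ X (hx a))
    (fun _ => (0, 1)) (fun a b h0 => ?_) (by simpa using hL)
  by_cases hb : ∃ a', overlap a' b = 1
  · obtain ⟨h, hval, hsep⟩ := hsep a b h0
    exact Or.inl ⟨h, convexHull_subset_halfSpace hval, hb, hsep⟩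
  · exact Or.inr ⟨(), fun a' ha' => absurd ⟨a', ha'⟩ hb, by simp⟩

variable [TopologicalSpace E] [IsTopologicalAddGroup E] [ContinuousSMul ℝ E] [T2Space E]
  [FiniteDimensional ℝ E]

/-- A lower bound on the `H`-free extension complexity of a polytope when all the inequalities of
`H` are implied by few inequalities that are valid for the polytope. -/
theorem le_hFreeExtensionComplexity {k L : ℕ} {X : Set E} (hX : X.Finite) {H D : Set (LinIneq E)}
    (hD : D.Finite) (hDX : convexHull ℝ X ⊆ solutionSet D) (hDH : solutionSet D ⊆ solutionSet H)
    (x : (Fin k → Bool) → E) (hx : ∀ a, x a ∈ X)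
    (hsep : ∀ a b, overlap a b = 0 → ∃ h, X ⊆ halfSpace h ∧ Separates x h a b)
    (hL : (L + (D.ncard + 1)) * 2 ^ k < 3 ^ k) :
    (L : ℕ∞) ≤ hFreeExtensionComplexity H (convexHull ℝ X) := by
  have hxX : ∀ a, x a ∈ convexHull ℝ X := fun a => subset_convexHull ℝ X (hx a)
  have : Fintype D := hD.fintype
  refine le_extensionComplexity (J := Option D) x (fun a h hh => hh.1.1 (hxX a))
    (fun j => j.elim (0, 1) fun h => h.1) (fun a b h0 => ?_)
    (by rwa [Fintype.card_option, ← Nat.card_eq_fintype_card, Nat.card_coe_set_eq])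
  by_cases hb : ∃ a', overlap a' b = 1
  · obtain ⟨a', ha'⟩ := hb
    obtain ⟨h, hval, htight, hlt⟩ := hsep a b h0
    obtain ⟨f, hf, hfh, hfa⟩ := exists_mem_facetInequalities hX hval ⟨_, hx a', htight a' ha'⟩
      (hx a) hlt
    -- A deleted facet inequality `f` is valid on `solutionSet D`, so some member of `D` is tight on
    -- its face and strict at `x a`.
    by_cases hfH : solutionSet H ⊆ halfSpace f
    · obtain ⟨g, hg, hgt, hga⟩ := exists_ineq_tight hD (hDH.trans hfH)
        (S := {y ∈ solutionSet D | f.1 y = f.2})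
        ((convex_solutionSet D).inter ((convex_singleton f.2).linear_preimage f.1))
        ⟨x a', hDX (hxX a'), hfh _ (hx a') (htight a' ha')⟩ (fun y hy => hy.1) (fun y hy => hy.2)
        (hDX (hxX a)) hfa
      exact Or.inr ⟨some ⟨g, hg⟩, fun a₁ ha₁ =>
        hgt _ ⟨hDX (hxX a₁), hfh _ (hx a₁) (htight a₁ ha₁)⟩, hga⟩
    · exact Or.inl ⟨f, fun y hy => hy f ⟨hf, hfH⟩, ⟨a', ha'⟩,
        fun a₁ ha₁ => hfh _ (hx a₁) (htight a₁ ha₁), hfa⟩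
  · exact Or.inr ⟨none, fun a' ha' => absurd ⟨a', ha'⟩ hb, by simp⟩

end ExtensionBound
-- Degree inequalities and odd-set inequalities
section DegreeInequalities

variable {V : Type*} (G : SimpleGraph V)

theorem incidenceVector_apply (M : G.Subgraph) {x y : V} (h : s(x, y) ∈ G.edgeSet)
    [Decidable (M.Adj x y)] :
    incidenceVector G M ⟨s(x, y), h⟩ = if M.Adj x y then 1 else 0 := by
  by_cases hM : M.Adj x y <;> simp [incidenceVector, hM]

theorem incidenceVector_nonneg (M : G.Subgraph) (e : G.edgeSet) : 0 ≤ incidenceVector G M e :=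
  Set.indicator_nonneg (fun _ _ => zero_le_one) _

theorem finite_setOf_incidenceVector [Finite V] (p : G.Subgraph → Prop) :
    {x | ∃ M : G.Subgraph, p M ∧ x = incidenceVector G M}.Finite :=
  (Set.finite_range (incidenceVector G)).subset fun _ ⟨M, _, hx⟩ => ⟨M, hx.symm⟩

variable [Fintype V]

theorem degreeInequalities_eq : degreeInequalities G =
    Set.range (fun e : G.edgeSet => ((-LinearMap.proj e, 0) : LinIneq (G.edgeSet → ℝ))) ∪
      Set.range fun v : V => (sumAt G v, 1) := by
  ext h
  simp only [degreeInequalities, Set.mem_ofPred_eq, Set.mem_union, Set.mem_range, eq_comm]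

theorem finite_degreeInequalities : (degreeInequalities G).Finite := by
  rw [degreeInequalities_eq]
  exact (Set.finite_range _).union (Set.finite_range _)

theorem ncard_degreeInequalities_le :
    (degreeInequalities G).ncard ≤ G.edgeSet.ncard + Fintype.card V := by
  classical
  rw [degreeInequalities_eq, ← Nat.card_coe_set_eq G.edgeSet, ← Nat.card_eq_fintype_card,
    ← Set.ncard_univ G.edgeSet, ← Set.ncard_univ V, ← Set.image_univ, ← Set.image_univ]
  exact (Set.ncard_union_le _ _).trans
    (Nat.add_le_add (Set.ncard_image_le Set.finite_univ) (Set.ncard_image_le Set.finite_univ))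

theorem inducedMatchingPolytope_subset :
    inducedMatchingPolytope G ⊆ solutionSet (degreeInequalities G) := by
  classical
  refine convexHull_min ?_ (convex_solutionSet _)
  rintro _ ⟨M, hM, -, rfl⟩ h (⟨e, rfl⟩ | ⟨v, rfl⟩)
  · simpa [halfSpace] using incidenceVector_nonneg G M e
  · simp only [halfSpace, sumAt, Set.mem_ofPred_eq, LinearMap.sum_apply, LinearMap.proj_apply]
    have hval : ∀ e : G.edgeSet, incidenceVector G M e = if e.1 ∈ M.edgeSet then 1 else 0 :=
      fun e => by simp [incidenceVector, Set.indicator_apply]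
    simp only [hval, Finset.sum_boole]
    norm_cast
    refine Finset.card_le_one.2 fun e he f hf => ?_
    simp only [Finset.mem_filter, Finset.mem_univ, true_and] at he hf
    obtain ⟨y, hy⟩ := he.1
    obtain ⟨z, hz⟩ := hf.1
    have h1 : M.Adj v y := by simpa [hy] using he.2
    have h2 : M.Adj v z := by simpa [hz] using hf.2
    exact Subtype.ext (by rw [hy, hz, (hM (M.edge_vert h1)).unique h1 h2])

/-- For a vertex set `T` meeting all the edges inside `S`, the degree inequalities bound the sum
over the edges inside `S` by `|T|`. -/
theorem sumInside_le_card {x : G.edgeSet → ℝ} (hx : x ∈ solutionSet (degreeInequalities G))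
    {S T : Finset V} (hT : ∀ e ∈ G.edgeSet, (∀ v ∈ e, v ∈ S) → ∃ v ∈ T, v ∈ e) :
    sumInside G S x ≤ T.card := by
  classical
  have hx0 : ∀ e, 0 ≤ x e := fun e => by
    simpa [halfSpace] using hx _ (Or.inl ⟨e, rfl⟩)
  have hx1 : ∀ v, sumAt G v x ≤ 1 := fun v => hx _ (Or.inr ⟨v, rfl⟩)
  calc sumInside G S x
      = ∑ e : G.edgeSet, if ∀ v ∈ e.1, v ∈ S then x e else 0 := by
        simp only [sumInside, LinearMap.sum_apply, Finset.sum_filter]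
        exact Finset.sum_congr rfl fun _ _ => by split_ifs <;> simp
    _ ≤ ∑ e : G.edgeSet, ∑ v ∈ T, if v ∈ e.1 then x e else 0 := by
        refine Finset.sum_le_sum fun e _ => ?_
        have hnn : ∀ v ∈ T, 0 ≤ if v ∈ e.1 then x e else 0 := fun v _ => by
          split_ifs <;> simp [hx0]
        split_ifs with h
        · obtain ⟨v, hvT, hve⟩ := hT e.1 e.2 h
          exact le_trans (by simp [hve]) (Finset.single_le_sum hnn hvT)
        · exact Finset.sum_nonneg hnn
    _ = ∑ v ∈ T, sumAt G v x := by
        rw [Finset.sum_comm]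
        refine Finset.sum_congr rfl fun v _ => ?_
        simp only [sumAt, LinearMap.sum_apply, Finset.sum_filter]
        exact Finset.sum_congr rfl fun _ _ => by split_ifs <;> simp
    _ ≤ ∑ _v ∈ T, (1 : ℝ) := Finset.sum_le_sum fun v _ => hx1 v
    _ = T.card := by simp

/-- Each colour class of `S` covers all edges inside `S`, and since |S| is odd the smaller class has
at most (|S| - 1) / 2 vertices. -/
theorem solutionSet_degreeInequalities_subset (hG : G.IsBipartite) :
    solutionSet (degreeInequalities G) ⊆ solutionSet (oddSetInequalities G) := by
  classical
  obtain ⟨c⟩ := hG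
  rintro x hx _ ⟨S, hodd, rfl⟩
  have key : ∀ i : Fin 2, sumInside G S x ≤ (S.filter fun v => c v = i).card := fun i => by
    refine sumInside_le_card G hx fun e he hS => ?_
    induction e with
    | _ y z =>
      have hne : c y ≠ c z := c.valid he
      have hy := hS y (by simp)
      have hz := hS z (by simp)
      by_cases hi : c y = i
      · exact ⟨y, by simp [hy, hi], by simp⟩
      · exact ⟨z, by simp only [Finset.mem_filter, hz, true_and]; omega, by simp⟩
  have hsum : (S.filter fun v => c v = 0).card + (S.filter fun v => c v = 1).card = S.card := by
    rw [← Finset.card_filter_add_card_filter_not (s := S) (p := fun v => c v = 0)]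
    congr 2
    ext v
    simp only [Finset.mem_filter, and_congr_right_iff]
    intro; omega
  have h0 := key 0
  have h1 := key 1
  obtain ⟨m, hm⟩ := hodd
  simp only [halfSpace, Set.mem_ofPred_eq]
  have hmin : (S.filter fun v => c v = 0).card ≤ m ∨ (S.filter fun v => c v = 1).card ≤ m := by
    omega
  have hle : sumInside G S x ≤ m := by
    rcases hmin with h | h
    · exact h0.trans (by exact_mod_cast h)
    · exact h1.trans (by exact_mod_cast h)
  rw [hm]
  push_cast
  linarith

end DegreeInequalities
-- The gadget graph, its induced matchings and its inequalities
section Gadget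

/-- The vertices of the gadget graph: a pendant edge `leaf i`, `base i` for every `i : Fin k`, and
a path `base i`, `left i j`, `mid i j`, `right i j`, `base j` for every pair `i j : Fin k`. -/
inductive GadgetVertex (k : ℕ) : Type
  | leaf (i : Fin k)
  | base (i : Fin k)
  | left (i j : Fin k)
  | right (i j : Fin k)
  | mid (i j : Fin k)

namespace GadgetVertex

/-- The vertices of the gadget graph as a sum type. -/
def equivSum (k : ℕ) : GadgetVertex k ≃
    (Fin k ⊕ Fin k) ⊕ ((Fin k × Fin k) ⊕ (Fin k × Fin k) ⊕ (Fin k × Fin k)) where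
  toFun
    | leaf i => .inl (.inl i)
    | base i => .inl (.inr i)
    | left i j => .inr (.inl (i, j))
    | right i j => .inr (.inr (.inl (i, j)))
    | mid i j => .inr (.inr (.inr (i, j)))
  invFun
    | .inl (.inl i) => leaf i
    | .inl (.inr i) => base i
    | .inr (.inl (i, j)) => left i j
    | .inr (.inr (.inl (i, j))) => right i j
    | .inr (.inr (.inr (i, j))) => mid i j
  left_inv x := by cases x <;> rfl
  right_inv x := by rcases x with (_ | _) | (_ | _ | _) <;> rfl

theorem card_eq (k : ℕ) : Nat.card (GadgetVertex k) = 2 * k + 3 * k ^ 2 := by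
  rw [Nat.card_congr (equivSum k)]
  simp
  ring

instance (k : ℕ) : Finite (GadgetVertex k) := .of_equiv _ (equivSum k).symm

/-- The edges of the gadget graph, in one of the two orientations. -/
def Edge {k : ℕ} : GadgetVertex k → GadgetVertex k → Prop
  | leaf i, base i' => i = i'
  | left i _, base i' => i = i'
  | right _ j, base j' => j = j'
  | left i j, mid i' j' => i = i' ∧ j = j'
  | right i j, mid i' j' => i = i' ∧ j = j'
  | _, _ => False

/-- The two sides of the gadget graph. -/
def side {k : ℕ} : GadgetVertex k → Bool
  | leaf _ | left _ _ | right _ _ => true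
  | base _ | mid _ _ => false

/-- The vertices of the induced matching encoding the set `a`. -/
def Covered {k : ℕ} (a : Fin k → Bool) : GadgetVertex k → Prop
  | leaf i | base i => a i
  | left i _ => ¬ a i
  | right i j => a i ∧ ¬ a j
  | mid i j => ¬ (a i ∧ a j)

theorem Edge.side_ne {k : ℕ} {x y : GadgetVertex k} (h : Edge x y) : side x ≠ side y := by
  cases x <;> cases y <;> simp_all [Edge, side]

end GadgetVertex

open GadgetVertex

/-- The gadget graph: the complete graph (with loops) on `Fin k` with both orientations of every
edge replaced by a path of length four and a pendant edge at every vertex. -/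
def gadgetGraph (k : ℕ) : SimpleGraph (GadgetVertex k) where
  Adj x y := Edge x y ∨ Edge y x
  symm := ⟨fun _ _ => Or.symm⟩
  loopless := ⟨fun _ h => h.elim (fun h => h.side_ne rfl) fun h => h.side_ne rfl⟩

theorem gadgetGraph_adj {k : ℕ} {x y : GadgetVertex k} :
    (gadgetGraph k).Adj x y ↔ Edge x y ∨ Edge y x := Iff.rfl

/-- The covered vertices induce a perfect matching: a covered `left` or `right` vertex has its
`base` neighbour uncovered, and a covered `mid` has exactly one covered neighbour, because `right i
j` needs `a i` while `left i j` excludes it. -/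
theorem gadgetGraph_existsUnique {k : ℕ} (a : Fin k → Bool) {x : GadgetVertex k}
    (hx : Covered a x) : ∃! y, Covered a y ∧ (gadgetGraph k).Adj x y := by
  cases x with
  | leaf i =>
    refine ⟨base i, ⟨hx, Or.inl rfl⟩, ?_⟩
    rintro (i' | i' | ⟨i', j'⟩ | ⟨i', j'⟩ | ⟨i', j'⟩) ⟨hy, h⟩ <;>
      simp_all [gadgetGraph_adj, Edge, Covered]
  | base i =>
    refine ⟨leaf i, ⟨hx, Or.inr rfl⟩, ?_⟩
    rintro (i' | i' | ⟨i', j'⟩ | ⟨i', j'⟩ | ⟨i', j'⟩) ⟨hy, h⟩ <;>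
      simp_all [gadgetGraph_adj, Edge, Covered]
  | left i j =>
    refine ⟨mid i j, ⟨fun h => hx h.1, Or.inl ⟨rfl, rfl⟩⟩, ?_⟩
    rintro (i' | i' | ⟨i', j'⟩ | ⟨i', j'⟩ | ⟨i', j'⟩) ⟨hy, h⟩ <;>
      simp_all [gadgetGraph_adj, Edge, Covered]
  | right i j =>
    refine ⟨mid i j, ⟨fun h => hx.2 h.2, Or.inl ⟨rfl, rfl⟩⟩, ?_⟩
    rintro (i' | i' | ⟨i', j'⟩ | ⟨i', j'⟩ | ⟨i', j'⟩) ⟨hy, h⟩ <;>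
      simp_all [gadgetGraph_adj, Edge, Covered]
  | mid i j =>
    by_cases ha : a i
    · refine ⟨right i j, ⟨⟨ha, fun h => hx ⟨ha, h⟩⟩, Or.inr ⟨rfl, rfl⟩⟩, ?_⟩
      rintro (i' | i' | ⟨i', j'⟩ | ⟨i', j'⟩ | ⟨i', j'⟩) ⟨hy, h⟩ <;>
        simp_all [gadgetGraph_adj, Edge, Covered]
    · refine ⟨left i j, ⟨ha, Or.inr ⟨rfl, rfl⟩⟩, ?_⟩
      rintro (i' | i' | ⟨i', j'⟩ | ⟨i', j'⟩ | ⟨i', j'⟩) ⟨hy, h⟩ <;>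
        simp_all [gadgetGraph_adj, Edge, Covered]

/-- The edges of the gadget graph. -/
def gadgetEdge {k : ℕ} :
    Fin k ⊕ (Fin k × Fin k) × Bool × Bool → GadgetVertex k × GadgetVertex k
  | .inl i => (leaf i, base i)
  | .inr ((i, j), true, true) => (left i j, base i)
  | .inr ((i, j), true, false) => (right i j, base j)
  | .inr ((i, j), false, true) => (left i j, mid i j)
  | .inr ((i, j), false, false) => (right i j, mid i j)

theorem exists_gadgetEdge {k : ℕ} {x y : GadgetVertex k} (h : Edge x y) :
    ∃ z, gadgetEdge z = (x, y) := by
  cases x <;> cases y <;> simp only [Edge] at h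
  · subst h; exact ⟨.inl _, rfl⟩
  · subst h; exact ⟨.inr ((_, _), true, true), rfl⟩
  · obtain ⟨rfl, rfl⟩ := h; exact ⟨.inr ((_, _), false, true), rfl⟩
  · subst h; exact ⟨.inr ((_, _), true, false), rfl⟩
  · obtain ⟨rfl, rfl⟩ := h; exact ⟨.inr ((_, _), false, false), rfl⟩

variable {V : Type*} {k : ℕ} (e : V ≃ GadgetVertex k)

theorem gadgetGraph_comap_isBipartite : ((gadgetGraph k).comap e).IsBipartite := by
  have c : ((gadgetGraph k).comap e).Coloring Bool := .mk (fun x => side (e x)) fun h =>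
    h.elim (fun h => h.side_ne) fun h => h.side_ne.symm
  simpa [SimpleGraph.IsBipartite] using c.colorable

theorem ncard_edgeSet_gadgetGraph_comap_le :
    ((gadgetGraph k).comap e).edgeSet.ncard ≤ k + 4 * k ^ 2 := by
  have hsub : ((gadgetGraph k).comap e).edgeSet ⊆ Set.range
      fun z : Fin k ⊕ (Fin k × Fin k) × Bool × Bool =>
        s(e.symm (gadgetEdge z).1, e.symm (gadgetEdge z).2) := by
    intro f hf
    induction f with
    | _ x y =>
      rcases hf with h | h
      · obtain ⟨z, hz⟩ := exists_gadgetEdge h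
        exact ⟨z, by simp [hz]⟩
      · obtain ⟨z, hz⟩ := exists_gadgetEdge h
        exact ⟨z, by simp [hz, Sym2.eq_swap]⟩
  refine (Set.ncard_le_ncard hsub).trans ?_
  rw [← Set.image_univ]
  refine (Set.ncard_image_le Set.finite_univ).trans ?_
  rw [Set.ncard_univ]
  simp
  apply le_of_eq
  ring

/-- The induced matching encoding the set `a`. -/
def gadgetMatching (a : Fin k → Bool) : ((gadgetGraph k).comap e).Subgraph :=
  (⊤ : ((gadgetGraph k).comap e).Subgraph).induce {x | Covered a (e x)}

theorem gadgetMatching_adj {a : Fin k → Bool} {x y : V} : (gadgetMatching e a).Adj x y ↔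
    Covered a (e x) ∧ Covered a (e y) ∧ (gadgetGraph k).Adj (e x) (e y) := by
  simp [gadgetMatching]

theorem gadgetMatching_isMatching (a : Fin k → Bool) : (gadgetMatching e a).IsMatching := by
  intro x hx
  obtain ⟨y, hy, hyu⟩ := gadgetGraph_existsUnique a (x := e x) hx
  refine ⟨e.symm y, (gadgetMatching_adj e).2 ⟨hx, by simpa using hy⟩, fun z hz => ?_⟩
  rw [Equiv.eq_symm_apply]
  exact hyu _ ((gadgetMatching_adj e).1 hz).2

theorem gadgetMatching_isInduced (a : Fin k → Bool) : (gadgetMatching e a).IsInduced :=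
  fun _ hx _ hy h => (gadgetMatching_adj e).2 ⟨hx, hy, h⟩

/-- The pendant edge at `base i`. -/
def pendantEdge (i : Fin k) : ((gadgetGraph k).comap e).edgeSet :=
  ⟨s(e.symm (leaf i), e.symm (base i)), by simp [gadgetGraph_adj, Edge]⟩

/-- The first of the two edges in the middle of the path from `base i` to `base j`. -/
def leftEdge (i j : Fin k) : ((gadgetGraph k).comap e).edgeSet :=
  ⟨s(e.symm (left i j), e.symm (mid i j)), by simp [gadgetGraph_adj, Edge]⟩

/-- The second of the two edges in the middle of the path from `base i` to `base j`. -/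
def rightEdge (i j : Fin k) : ((gadgetGraph k).comap e).edgeSet :=
  ⟨s(e.symm (right i j), e.symm (mid i j)), by simp [gadgetGraph_adj, Edge]⟩

theorem incidenceVector_pendantEdge (M : ((gadgetGraph k).comap e).Subgraph) (i : Fin k)
    [Decidable (M.Adj (e.symm (leaf i)) (e.symm (base i)))] :
    incidenceVector _ M (pendantEdge e i) =
      if M.Adj (e.symm (leaf i)) (e.symm (base i)) then 1 else 0 :=
  incidenceVector_apply _ M _

theorem incidenceVector_leftEdge (M : ((gadgetGraph k).comap e).Subgraph) (i j : Fin k)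
    [Decidable (M.Adj (e.symm (left i j)) (e.symm (mid i j)))] :
    incidenceVector _ M (leftEdge e i j) =
      if M.Adj (e.symm (left i j)) (e.symm (mid i j)) then 1 else 0 :=
  incidenceVector_apply _ M _

theorem incidenceVector_rightEdge (M : ((gadgetGraph k).comap e).Subgraph) (i j : Fin k)
    [Decidable (M.Adj (e.symm (right i j)) (e.symm (mid i j)))] :
    incidenceVector _ M (rightEdge e i j) =
      if M.Adj (e.symm (right i j)) (e.symm (mid i j)) then 1 else 0 :=
  incidenceVector_apply _ M _

/-- The inequality for the set `b`; its slack at the induced matching encoding `a` is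
`(1 - |a ∩ b|) ^ 2`. -/
noncomputable def gadgetIneq (b : Fin k → Bool) :
    LinIneq (((gadgetGraph k).comap e).edgeSet → ℝ) :=
  (∑ i, (if b i then (2 : ℝ) else 0) • LinearMap.proj (R := ℝ) (φ := fun _ => ℝ) (pendantEdge e i) +
    ∑ i, ∑ j, (if b i ∧ b j then (1 : ℝ) else 0) •
      (LinearMap.proj (R := ℝ) (φ := fun _ => ℝ) (leftEdge e i j) +
        LinearMap.proj (R := ℝ) (φ := fun _ => ℝ) (rightEdge e i j)),
    1 + ∑ i, ∑ j, if b i ∧ b j then (1 : ℝ) else 0)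

/-- Expanding the square produces products over all ordered pairs, the diagonal included; hence the
loops and both orientations in the gadget. -/
theorem gadgetIneq_sub_apply (b : Fin k → Bool) (x : ((gadgetGraph k).comap e).edgeSet → ℝ) :
    (gadgetIneq e b).2 - (gadgetIneq e b).1 x =
      (1 - ∑ i, if b i then x (pendantEdge e i) else 0) ^ 2 +
      ∑ i, ∑ j, if b i ∧ b j then 1 - x (leftEdge e i j) - x (rightEdge e i j) -
        x (pendantEdge e i) * x (pendantEdge e j) else 0 := by
  have h1 : ∀ i, (if b i then (2 : ℝ) else 0) * x (pendantEdge e i) =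
      2 * if b i then x (pendantEdge e i) else 0 := fun i => by split_ifs <;> simp
  have h2 : ∀ i j, (if b i ∧ b j then 1 - x (leftEdge e i j) - x (rightEdge e i j) -
        x (pendantEdge e i) * x (pendantEdge e j) else 0) =
      (if b i ∧ b j then 1 else 0) - (if b i ∧ b j then (1 : ℝ) else 0) *
        (x (leftEdge e i j) + x (rightEdge e i j)) -
      (if b i then x (pendantEdge e i) else 0) * if b j then x (pendantEdge e j) else 0 :=
    fun i j => by by_cases hi : b i <;> by_cases hj : b j <;> simp [hi, hj]; ring
  simp only [gadgetIneq, LinearMap.add_apply, LinearMap.sum_apply, LinearMap.smul_apply,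
    LinearMap.proj_apply, smul_eq_mul, h1, h2, Finset.sum_sub_distrib, ← Finset.mul_sum,
    ← Finset.sum_mul]
  ring

open Classical in
-- Every term of the double sum is nonnegative: the two middle edges share `mid i j`, and in an
-- induced matching the left one excludes the pendant edge at `base i`, the right one that at `base
-- j`.
theorem gadgetIneq_valid (b : Fin k → Bool) {M : ((gadgetGraph k).comap e).Subgraph}
    (hM : M.IsMatching) (hI : M.IsInduced) :
    incidenceVector _ M ∈ halfSpace (gadgetIneq e b) := by
  have hconf : ∀ {x y v z : V}, M.Adj x v → M.Adj y z → (gadgetGraph k).Adj (e x) (e y) →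
      v = y := fun h1 h2 h =>
    (hM (M.edge_vert h1)).unique h1 (hI (M.edge_vert h1) (M.edge_vert h2) h)
  rw [halfSpace, Set.mem_ofPred_eq, ← sub_nonneg, gadgetIneq_sub_apply]
  refine add_nonneg (sq_nonneg _) (Finset.sum_nonneg fun i _ => Finset.sum_nonneg fun j _ => ?_)
  split_ifs
  · have h1 : ¬ (M.Adj (e.symm (left i j)) (e.symm (mid i j)) ∧
        M.Adj (e.symm (right i j)) (e.symm (mid i j))) := fun ⟨h1, h2⟩ => by
      simpa using (hM (M.edge_vert h1.symm)).unique h1.symm h2.symm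
    have h2 : ¬ (M.Adj (e.symm (leaf i)) (e.symm (base i)) ∧
        M.Adj (e.symm (left i j)) (e.symm (mid i j))) := fun ⟨h1, h2⟩ => by
      simpa using hconf h1.symm h2 (by simp [gadgetGraph_adj, Edge])
    have h3 : ¬ (M.Adj (e.symm (leaf j)) (e.symm (base j)) ∧
        M.Adj (e.symm (right i j)) (e.symm (mid i j))) := fun ⟨h1, h2⟩ => by
      simpa using hconf h1.symm h2 (by simp [gadgetGraph_adj, Edge])
    simp only [incidenceVector_pendantEdge, incidenceVector_leftEdge, incidenceVector_rightEdge]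
    split_ifs <;> simp_all
  · exact le_rfl

theorem gadgetIneq_separates {a b : Fin k → Bool} (h : overlap a b = 0) :
    Separates (fun a => incidenceVector _ (gadgetMatching e a)) (gadgetIneq e b) a b := by
  classical
  have key : ∀ a : Fin k → Bool,
      (gadgetIneq e b).2 - (gadgetIneq e b).1 (incidenceVector _ (gadgetMatching e a)) =
        (1 - overlap a b : ℝ) ^ 2 := fun a => by
    rw [gadgetIneq_sub_apply]
    have hp : ∀ i, incidenceVector _ (gadgetMatching e a) (pendantEdge e i) =
        if a i then 1 else 0 := fun i => by
      simp [incidenceVector_pendantEdge, gadgetMatching_adj, Covered, gadgetGraph_adj, Edge]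
    have hl : ∀ i j, incidenceVector _ (gadgetMatching e a) (leftEdge e i j) =
        if a i then 0 else 1 := fun i j => by
      by_cases hi : a i <;>
      simp [incidenceVector_leftEdge, gadgetMatching_adj, Covered, gadgetGraph_adj, Edge, hi]
    have hr : ∀ i j, incidenceVector _ (gadgetMatching e a) (rightEdge e i j) =
        if a i ∧ ¬ a j then 1 else 0 := fun i j => by
      by_cases hi : a i <;> by_cases hj : a j <;>
      simp [incidenceVector_rightEdge, gadgetMatching_adj, Covered, gadgetGraph_adj, Edge,
        hi, hj]
    have h0 : ∀ i j, (1 : ℝ) - (if a i then 0 else 1) - (if a i ∧ ¬ a j then 1 else 0) -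
        (if a i then 1 else 0) * (if a j then 1 else 0) = 0 := fun i j => by
      by_cases hi : a i <;> by_cases hj : a j <;> simp [hi, hj]
    have hov : (overlap a b : ℝ) = ∑ i, if b i then (if a i then (1 : ℝ) else 0) else 0 := by
      rw [overlap]
      push_cast
      exact Finset.sum_congr rfl fun i _ => by
        by_cases hi : a i <;> by_cases hj : b i <;> simp [hi, hj]
    simp only [hp, hl, hr, h0, hov, ite_self, Finset.sum_const_zero, add_zero]
  constructor
  · intro a' ha'
    have := key a'
    rw [ha'] at this
    norm_num at this
    linarith
  · have := key a
    rw [h] at this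
    norm_num at this
    linarith

end Gadget
-- Choice of parameters and the main theorem
section WorstCase

variable {V : Type*} {k : ℕ} (e : V ≃ GadgetVertex k)

/-- The induced matching polytope of the gadget graph has exponential extension complexity. -/
theorem le_extensionComplexity_gadgetGraph {L : ℕ} (hL : (L + 1) * 2 ^ k < 3 ^ k) :
    (L : ℕ∞) ≤ extensionComplexity (inducedMatchingPolytope ((gadgetGraph k).comap e)) :=
  le_extensionComplexity_convexHull (fun a => incidenceVector _ (gadgetMatching e a))
    (fun a => ⟨_, gadgetMatching_isMatching e a, gadgetMatching_isInduced e a, rfl⟩)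
    (fun _ b h => ⟨gadgetIneq e b, by
      rintro _ ⟨M, hM, hI, rfl⟩
      exact gadgetIneq_valid e b hM hI, gadgetIneq_separates e h⟩) hL

/-- So does its residual polyhedron with respect to the odd-set inequalities. -/
theorem le_hFreeExtensionComplexity_gadgetGraph [Fintype V] {L : ℕ}
    (hL : (L + (3 * k + 7 * k ^ 2 + 1)) * 2 ^ k < 3 ^ k) :
    (L : ℕ∞) ≤ hFreeExtensionComplexity (oddSetInequalities ((gadgetGraph k).comap e))
      (inducedMatchingPolytope ((gadgetGraph k).comap e)) := by
  refine le_hFreeExtensionComplexity ?_ (finite_degreeInequalities _)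
    (inducedMatchingPolytope_subset _)
    (solutionSet_degreeInequalities_subset _ (gadgetGraph_comap_isBipartite e))
    (fun a => incidenceVector _ (gadgetMatching e a))
    (fun a => ⟨_, gadgetMatching_isMatching e a, gadgetMatching_isInduced e a, rfl⟩)
    (fun _ b h => ⟨gadgetIneq e b, by
      rintro _ ⟨M, hM, hI, rfl⟩
      exact gadgetIneq_valid e b hM hI, gadgetIneq_separates e h⟩)
    (lt_of_le_of_lt (Nat.mul_le_mul_right _ ?_) hL)
  · simpa only [and_assoc] using finite_setOf_incidenceVector ((gadgetGraph k).comap e)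
      fun M => M.IsMatching ∧ M.IsInduced
  · have h1 := ncard_degreeInequalities_le ((gadgetGraph k).comap e)
    have h2 := ncard_edgeSet_gadgetGraph_comap_le e
    have h3 := (Nat.card_eq_fintype_card (α := V)).symm.trans
      ((Nat.card_congr e).trans (GadgetVertex.card_eq k))
    omega

/-- The summand 3k + 7k² bounds the number of degree inequalities. Of the final 2, one pays for the
trivial inequality and one for rounding (5/4)^k up to an integer. -/
theorem polynomial_add_pow_lt {k : ℕ} (hk : 24 ≤ k) :
    (5 / 4 : ℝ) ^ k + (3 * k + 7 * k ^ 2 + 2) < (3 / 2) ^ k := by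
  induction k, hk using Nat.le_induction with
  | base => norm_num
  | succ k hk ih =>
    have hk' : (24 : ℝ) ≤ k := by exact_mod_cast hk
    have h0 : (0 : ℝ) < (5 / 4) ^ k := by positivity
    rw [pow_succ (5 / 4 : ℝ), pow_succ (3 / 2 : ℝ)]
    push_cast
    nlinarith [mul_le_mul_of_nonneg_right hk' (Nat.cast_nonneg (α := ℝ) k)]

theorem exists_nat_bound {k : ℕ} (hk : 24 ≤ k) : ∃ L : ℕ, (2 : ℝ) ^ ((k : ℝ) / 4) ≤ L ∧
    (L + (3 * k + 7 * k ^ 2 + 1)) * 2 ^ k < 3 ^ k := by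
  refine ⟨⌈(5 / 4 : ℝ) ^ k⌉₊, le_trans ?_ (Nat.le_ceil _), ?_⟩
  · have h : (2 : ℝ) ^ (1 / 4 : ℝ) ≤ 5 / 4 := by
      rw [show (1 / 4 : ℝ) = ((4 : ℕ) : ℝ)⁻¹ by norm_num]
      refine (Real.rpow_le_rpow (by norm_num) (show (2 : ℝ) ≤ (5 / 4) ^ 4 by norm_num)
        (by norm_num)).trans_eq ?_
      exact Real.pow_rpow_inv_natCast (by norm_num) (by norm_num)
    rw [show (k : ℝ) / 4 = 1 / 4 * k by ring, Real.rpow_mul (by norm_num), Real.rpow_natCast]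
    exact pow_le_pow_left₀ (by positivity) h k
  · have h1 := polynomial_add_pow_lt hk
    have h2 := Nat.ceil_lt_add_one (show (0 : ℝ) ≤ (5 / 4) ^ k by positivity)
    rw [div_pow (3 : ℝ), lt_div_iff₀ (by positivity)] at h1
    have h3 : ((⌈(5 / 4 : ℝ) ^ k⌉₊ : ℝ) + (3 * k + 7 * k ^ 2 + 1)) * 2 ^ k < 3 ^ k :=
      lt_of_le_of_lt (mul_le_mul_of_nonneg_right (by linarith) (by positivity)) h1
    exact_mod_cast h3

end WorstCase
end HFree

theorem mainTheorem3 :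
    (∃ (C : ℕ) (c : ℝ), 0 < c ∧ ∀ n : ℕ, 1 ≤ n →
      ∃ (N : ℕ) (G : SimpleGraph (Fin N)),
        G.IsBipartite ∧ N ≤ C * n ∧ G.edgeSet.ncard ≤ C * n ∧
        ENNReal.ofReal ((2 : ℝ) ^ (c * (n : ℝ) ^ (1 / 4 : ℝ))) ≤
          ((HFree.extensionComplexity (HFree.inducedMatchingPolytope G) : ℕ∞) : ℝ≥0∞) ∧
        ENNReal.ofReal ((2 : ℝ) ^ (c * (n : ℝ) ^ (1 / 4 : ℝ))) ≤
          ((HFree.hFreeExtensionComplexity (HFree.oddSetInequalities G)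
            (HFree.inducedMatchingPolytope G) : ℕ∞) : ℝ≥0∞)) ∧
    (∀ (N : ℕ) (G : SimpleGraph (Fin N)), G.IsBipartite →
      HFree.inducedMatchingPolytope G ⊆ HFree.solutionSet (HFree.degreeInequalities G) ∧
      HFree.solutionSet (HFree.degreeInequalities G) ⊆
        HFree.solutionSet (HFree.oddSetInequalities G)) := by
  refine ⟨⟨5000, 1 / 4, by norm_num, fun n hn => ?_⟩, fun N G hG =>
    ⟨HFree.inducedMatchingPolytope_subset G, HFree.solutionSet_degreeInequalities_subset G hG⟩⟩
  have hs : 1 ≤ n.sqrt := Nat.le_sqrt.2 (by omega)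
  have hs2 : n.sqrt * n.sqrt ≤ n := Nat.sqrt_le n
  -- Adding 24 reaches the threshold of the numerical estimate for every n. As √n rounded down is at
  -- least 1, k is at most 25 times it, so k² ≤ 625 n, and the vertex and edge counts, at most 5k²
  -- each, stay below 5000 n.
  obtain ⟨k, hk⟩ : ∃ k, k = n.sqrt + 24 := ⟨_, rfl⟩
  have hk2 : k ^ 2 ≤ 625 * n := by
    subst hk
    nlinarith
  have hk1 : k ≤ k ^ 2 := Nat.le_self_pow two_ne_zero k
  have hnk : (n : ℝ) ^ (1 / 4 : ℝ) ≤ k := by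
    have hn1 : (1 : ℝ) ≤ n := by exact_mod_cast hn
    calc (n : ℝ) ^ (1 / 4 : ℝ) ≤ (n : ℝ) ^ (1 / 2 : ℝ) :=
          Real.rpow_le_rpow_of_exponent_le hn1 (by norm_num)
      _ = √n := (Real.sqrt_eq_rpow _).symm
      _ ≤ (n.sqrt : ℝ) + 1 := Real.real_sqrt_le_nat_sqrt_succ
      _ ≤ k := by rw [hk]; push_cast; linarith
  obtain ⟨L, hkL, hL⟩ := HFree.exists_nat_bound (k := k) (by omega)
  have hbound : ENNReal.ofReal ((2 : ℝ) ^ (1 / 4 * (n : ℝ) ^ (1 / 4 : ℝ))) ≤ L := by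
    rw [← ENNReal.ofReal_natCast L]
    refine ENNReal.ofReal_le_ofReal (le_trans ?_ hkL)
    exact Real.rpow_le_rpow_of_exponent_le one_le_two (by linarith)
  have e := (Finite.equivFin (HFree.GadgetVertex k)).symm
  refine ⟨_, (HFree.gadgetGraph k).comap e, HFree.gadgetGraph_comap_isBipartite e, ?_,
    (HFree.ncard_edgeSet_gadgetGraph_comap_le e).trans (by omega), hbound.trans ?_,
    hbound.trans ?_⟩
  · rw [HFree.GadgetVertex.card_eq]
    omega
  · have := HFree.le_extensionComplexity_gadgetGraph e (L := L)
      (lt_of_le_of_lt (Nat.mul_le_mul_right _ (by omega)) hL)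
    exact_mod_cast ENat.toENNReal_le.2 this
  · exact_mod_cast ENat.toENNReal_le.2 (HFree.le_hFreeExtensionComplexity_gadgetGraph e hL)
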